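/- Let $G$ be an abelian group and let $n$ be a non-negative integer or $\infty$. A closed subset $A$ of a topological space $X$ is called a $G$-homological $Z_n$-set in $X$ if for every open set $U\subset X$ and every integer $0\le k<n+1$ the relative singular homology group $H_k(U,U\setminus A;G)$ is trivial. For a prime $p$ let $\mathbb Z_p=\mathbb Z/p\mathbb Z$, let $R_p$ be the additive group of rational numbers whose denominator (in lowest terms) is not divisible by $p$, and let $\mathbb Q_p=\mathbb Q/R_p$ be the quasicyclic $p$-group. Let $\mathrm{Tor}(G)$ be the torsion subgroup of $G$ and $p\text{-}\mathrm{Tor}(G)=\{x\in G:\exists k\in\mathbb N,\ p^kx=0\}$. A group is divisible by a positive integer $m$ if each of its elements has the form $mx$ with $x$ in the group, and divisible if it is divisible by every positive integer $m$. The Bockstein family $\sigma(G)\subset\{\mathbb Q,\mathbb Z_p,\mathbb Q_p,R_p : p\text{ prime}\}$ is defined by: - $\mathbb Q\in\sigma(G)$ if and only if $G/\mathrm{Tor}(G)$ is non-trivial and divisible; - $R_p\in\sigma(G)$ if and only if $G/p\text{-}\mathrm{Tor}(G)$ is not divisible by $p$; - $\mathbb Z_p\in\sigma(G)$ if and only if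 $p\text{-}\mathrm{Tor}(G)$ is not divisible by $p$; - $\mathbb Q_p\in\sigma(G)$ if and only if $p\text{-}\mathrm{Tor}(G)$ is non-trivial and divisible by $p$. **Theorem.** A closed subset $A$ of a topological space $X$ is a $G$-homological $Z_n$-set in $X$ if and only if $A$ is an $H$-homological $Z_n$-set in $X$ for every group $H\in\sigma(G)$. -/

import Mathlib

open CategoryTheory CategoryTheory.Limits

universe u v

noncomputable section

namespace Bockstein

/-! ### Relative singular homology -/

/-- The complex of singular chains of the space `Y` with coefficients in the abelian group `G`
(as a complex of `ℤ`-modules; `ULift` only adjusts universes). -/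
def singularChains (Y : Type u) [TopologicalSpace Y] (G : Type v) [AddCommGroup G] :
    ChainComplex (ModuleCat.{max v u} ℤ) ℕ :=
  ((AlgebraicTopology.singularChainComplexFunctor.{u} (ModuleCat.{max v u} ℤ)).obj
    (ModuleCat.of ℤ (ULift.{u} G))).obj (TopCat.of Y)

/-- The map on singular chains induced by the inclusion of a subspace `B ⊆ Y`. -/
def singularChainsIncl {Y : Type u} [TopologicalSpace Y] (B : Set Y)
    (G : Type v) [AddCommGroup G] : singularChains B G ⟶ singularChains Y G :=
  ((AlgebraicTopology.singularChainComplexFunctor.{u} (ModuleCat.{max v u} ℤ)).obj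
    (ModuleCat.of ℤ (ULift.{u} G))).map
      (TopCat.ofHom ⟨(Subtype.val : B → Y), continuous_subtype_val⟩)

/-- The relative singular chain complex `C_*(Y; G) / C_*(B; G)` of the pair `(Y, B)`. -/
def relSingularChains {Y : Type u} [TopologicalSpace Y] (B : Set Y)
    (G : Type v) [AddCommGroup G] : ChainComplex (ModuleCat.{max v u} ℤ) ℕ :=
  cokernel (singularChainsIncl B G)

/-- The relative singular homology group `H_k(Y, B; G)`. -/
def relSingularHomology (k : ℕ) {Y : Type u} [TopologicalSpace Y] (B : Set Y)
    (G : Type v) [AddCommGroup G] : ModuleCat.{max v u} ℤ :=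
  (relSingularChains B G).homology k

/-! ### Homological `Z_n`-sets -/

/-- `A` is a `G`-homological `Z_n`-set in `X` (`n` a non-negative integer or infinity): `A` is
closed and `H_k(U, U \ A; G) = 0` for every open set `U ⊆ X` and every `k < n + 1`. -/
def IsHomologicalZSet (G : Type v) [AddCommGroup G] (n : ℕ∞)
    {X : Type u} [TopologicalSpace X] (A : Set X) : Prop :=
  IsClosed A ∧ ∀ U : Set X, IsOpen U → ∀ k : ℕ, (k : ℕ∞) < n + 1 →
    Subsingleton (relSingularHomology k {x : U | (x : X) ∉ A} G)

/-! ### Bockstein groups -/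

/-- The group `R_p` of rational numbers whose denominator is not divisible by the prime `p`. -/
def localRat (p : Nat.Primes) : AddSubgroup ℚ where
  carrier := {q | ¬ (p : ℕ) ∣ q.den}
  zero_mem' := by
    simpa using p.2.one_lt.ne'
  add_mem' {a b} ha hb := fun h =>
    (p.2.dvd_mul.1 (h.trans (Rat.add_den_dvd a b))).elim ha hb
  neg_mem' {a} ha := by simpa using ha

/-- Labels for the Bockstein groups `ℚ`, `ℤ_p`, `ℚ_p`, `R_p` (`p` prime). -/
inductive BocksteinGroup : Type
  | rat : BocksteinGroup
  | cyclic (p : Nat.Primes) : BocksteinGroup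
  | quasicyclic (p : Nat.Primes) : BocksteinGroup
  | localized (p : Nat.Primes) : BocksteinGroup

namespace BocksteinGroup

/-- The Bockstein group with a given label: `ℚ`, `ℤ_p = ℤ/pℤ`, the quasicyclic group
`ℚ_p = ℚ/R_p`, or `R_p`. -/
def Carrier : BocksteinGroup → Type
  | rat => ℚ
  | cyclic p => ZMod (p : ℕ)
  | quasicyclic p => ℚ ⧸ localRat p
  | localized p => localRat p

instance (H : BocksteinGroup) : AddCommGroup H.Carrier :=
  match H with
  | rat => inferInstanceAs (AddCommGroup ℚ)
  | cyclic p => inferInstanceAs (AddCommGroup (ZMod (p : ℕ)))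
  | quasicyclic p => inferInstanceAs (AddCommGroup (ℚ ⧸ localRat p))
  | localized p => inferInstanceAs (AddCommGroup (localRat p))

end BocksteinGroup

/-! ### The Bockstein family -/

/-- `G` is divisible by the natural number `m`: every `g : G` has the form `m • x`. -/
def IsDivisibleBy (G : Type v) [AddCommGroup G] (m : ℕ) : Prop :=
  ∀ g : G, ∃ x : G, m • x = g

/-- `G` is divisible: it is divisible by every positive integer. -/
def IsDivisible (G : Type v) [AddCommGroup G] : Prop :=
  ∀ m : ℕ, 0 < m → IsDivisibleBy G m

/-- The `p`-torsion part `{x : G | ∃ k, p ^ k • x = 0}` of `G`. -/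
abbrev pTor (G : Type v) [AddCommGroup G] (p : Nat.Primes) : AddSubgroup G :=
  AddCommGroup.primaryComponent G (p : ℕ)

/-- The Bockstein family `σ(G)` of an abelian group `G`. -/
def bocksteinFamily (G : Type v) [AddCommGroup G] : Set BocksteinGroup :=
  {H | match H with
    | .rat => Nontrivial (G ⧸ AddCommGroup.torsion G) ∧ IsDivisible (G ⧸ AddCommGroup.torsion G)
    | .localized p => ¬ IsDivisibleBy (G ⧸ pTor G p) (p : ℕ)
    | .cyclic p => ¬ IsDivisibleBy (pTor G p) (p : ℕ)
    | .quasicyclic p => Nontrivial (pTor G p) ∧ IsDivisibleBy (pTor G p) (p : ℕ)}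

end Bockstein

end

/-! The statement can be checked for one pair (U, U \ A) and one degree k at a time. Let C be the
integral relative singular complex of the pair. Its chain groups are torsion-free, hence flat, and
the relative chains with coefficients in G are C ⊗ G. By universal coefficients, H_k(C ⊗ G) = 0
exactly when H_k(C) ⊗ G = 0 and Tor(H_{k-1}(C), G) = 0; this is `exact_rTensor_iff`. There
H_{k-1}(C) is replaced by the cokernel of C_k → C_{k-1}, which has the same torsion because C_{k-2}
is torsion-free.

What remains is algebra: how much of G do these two conditions see? The Tor condition says that no
prime p is the order of an element in both groups (`injective_rTensor_iff`). The product H ⊗ G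
vanishes (`subsingleton_tensor_iff`) exactly when, for each p, one factor is p-divisible; one factor
is torsion; and whenever one factor has p-torsion, the other is p-divisible modulo its own
p-torsion. So G enters only through p-divisibility, being torsion, having p-torsion, and
p-divisibility of G/p-Tor(G). Which of these fail for G is recorded by σ(G), and each Bockstein
group tests the corresponding conditions on H (`tensorVanishing_iff_forall_bocksteinFamily`,
`noTorsionBy_or_iff_forall_bocksteinFamily`). -/

namespace Bockstein

open scoped TensorProduct

/-! ### Vanishing of tensor products of abelian groups -/

section TensorVanishing

variable {M : Type*} {N : Type*} [AddCommGroup M] [AddCommGroup N]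

/-- The group has no nontrivial elements of order `p`. -/
def NoTorsionBy (M : Type*) [AddCommGroup M] (p : ℕ) : Prop := ∀ x : M, p • x = 0 → x = 0

/-- Every element has finite order. -/
def AllTorsion (M : Type*) [AddCommGroup M] : Prop := ∀ x : M, ∃ m : ℕ, 0 < m ∧ m • x = 0

/-- The quotient by the `p`-torsion is divisible by `p`, stated elementwise. -/
def IsDivisibleModTorsion (M : Type*) [AddCommGroup M] (p : ℕ) : Prop :=
  ∀ x : M, ∃ (y : M) (k : ℕ), p ^ k • (x - p • y) = 0

lemma IsDivisibleBy.modTorsion {p : ℕ} (h : IsDivisibleBy M p) : IsDivisibleModTorsion M p := by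
  intro x
  obtain ⟨y, hy⟩ := h x
  exact ⟨y, 0, by simp [hy]⟩

lemma IsDivisibleBy.pow {p : ℕ} (h : IsDivisibleBy M p) (k : ℕ) : IsDivisibleBy M (p ^ k) := by
  induction k with
  | zero => exact fun x => ⟨x, by simp⟩
  | succ k ih =>
    intro x
    obtain ⟨y, rfl⟩ := h x
    obtain ⟨z, rfl⟩ := ih y
    exact ⟨z, by rw [pow_succ', mul_smul]⟩

lemma IsDivisibleModTorsion.pow {p : ℕ} (h : IsDivisibleModTorsion M p) (n : ℕ) (x : M) :
    ∃ (y : M) (k : ℕ), p ^ k • (x - p ^ n • y) = 0 := by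
  induction n with
  | zero => exact ⟨x, 0, by simp⟩
  | succ n ih =>
    obtain ⟨y, k, hy⟩ := ih
    obtain ⟨z, l, hz⟩ := h y
    refine ⟨z, k + l, ?_⟩
    have e : x - p ^ (n + 1) • z = (x - p ^ n • y) + p ^ n • (y - p • z) := by
      rw [smul_sub, smul_smul, pow_succ]; abel
    rw [e, smul_add, pow_add, mul_comm, mul_smul, hy, smul_zero, zero_add, mul_comm, mul_smul,
      smul_comm (p ^ l), hz, smul_zero, smul_zero]

/-- Tensoring ℤ → ℤ → ℤ/n with `M` is right exact, so M ⊗ ℤ/n is M/nM and x ⊗ 1 is the class of `x`.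
-/
lemma exists_smul_eq_of_tmul_one_eq_zero (n : ℕ) (x : M)
    (hx : x ⊗ₜ[ℤ] (1 : ZMod n) = 0) : ∃ y : M, n • y = x := by
  have hex : Function.Exact (LinearMap.lsmul ℤ ℤ (n : ℤ))
      (Int.castAddHom (ZMod n)).toIntLinearMap := by
    intro a
    change ((a : ZMod n) = 0) ↔ _
    rw [ZMod.intCast_zmod_eq_zero_iff_dvd a n]
    constructor
    · rintro ⟨c, rfl⟩; exact ⟨c, rfl⟩
    · rintro ⟨c, rfl⟩; exact ⟨c, rfl⟩
  have hs : Function.Surjective (Int.castAddHom (ZMod n)).toIntLinearMap :=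
    ZMod.intCast_surjective
  have h0 : (Int.castAddHom (ZMod n)).toIntLinearMap.lTensor M (x ⊗ₜ[ℤ] (1 : ℤ)) = 0 := by
    simpa using hx
  obtain ⟨t, ht⟩ := (lTensor_exact M hex hs _).1 h0
  refine ⟨TensorProduct.rid ℤ M t, ?_⟩
  have h1 := congrArg (TensorProduct.rid ℤ M) ht
  have h2 : ∀ t, TensorProduct.rid ℤ M ((LinearMap.lsmul ℤ ℤ (n : ℤ)).lTensor M t) =
      n • TensorProduct.rid ℤ M t := by
    intro t
    induction t with
    | zero => simp
    | add a b ha hb => simp only [map_add, ha, hb, smul_add]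
    | tmul a b => simp [mul_smul]
  rw [h2] at h1
  simpa using h1

lemma isDivisibleBy_of_subsingleton_tensor_zmod {n : ℕ} [Subsingleton (M ⊗[ℤ] ZMod n)] :
    IsDivisibleBy M n := fun x =>
  exists_smul_eq_of_tmul_one_eq_zero n x (Subsingleton.elim _ _)

/-- The map `ZMod n → M` sending `1` to an element killed by `n`. -/
lemma exists_zmod_linearMap {n : ℕ} (x : M) (hx : n • x = 0) :
    ∃ f : ZMod n →ₗ[ℤ] M, f 1 = x := by
  refine ⟨(ZMod.lift n ⟨zmultiplesHom M x, by simpa using hx⟩).toIntLinearMap, ?_⟩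
  have := ZMod.lift_coe n ⟨zmultiplesHom M x, by simpa using hx⟩ (1 : ℤ)
  simpa using this

lemma exists_injective_zmod_linearMap {p : ℕ} (hp : p.Prime) (x : M) (hx : p • x = 0)
    (hx0 : x ≠ 0) : ∃ f : ZMod p →ₗ[ℤ] M, f 1 = x ∧ Function.Injective f := by
  obtain ⟨f, hf⟩ := exists_zmod_linearMap x hx
  refine ⟨f, hf, (injective_iff_map_eq_zero f).2 fun a ha => ?_⟩
  by_contra ha0
  have := Fact.mk hp
  obtain ⟨k, hk⟩ := ZMod.intCast_surjective (a⁻¹)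
  have h1 : k • a = 1 := by
    rw [zsmul_eq_mul, hk, inv_mul_cancel₀ ha0]
  apply hx0
  rw [← hf, ← h1, map_zsmul, ha, smul_zero]

lemma exists_addMonoidHom_zmod_ne_zero_of_module {p : ℕ} [Fact p.Prime] [Module (ZMod p) M]
    {x : M} (hx : x ≠ 0) : ∃ f : M →+ ZMod p, f x ≠ 0 := by
  obtain ⟨f, hf⟩ := Module.Projective.exists_dual_ne_zero (ZMod p) hx
  exact ⟨f.toAddMonoidHom, hf⟩

lemma exists_addMonoidHom_zmod_ne_zero {p : ℕ} [Fact p.Prime] (hM : ∀ x : M, p • x = 0) {x : M}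
    (hx : x ≠ 0) : ∃ f : M →+ ZMod p, f x ≠ 0 :=
  letI := AddCommGroup.zmodModule hM
  exists_addMonoidHom_zmod_ne_zero_of_module hx

/-- A group which is not divisible by `p` surjects onto `ZMod p`. -/
lemma exists_surjective_zmod {p : ℕ} (hp : p.Prime) (h : ¬ IsDivisibleBy M p) :
    ∃ f : M →ₗ[ℤ] ZMod p, Function.Surjective f := by
  have := Fact.mk hp
  -- M/pM is a nonzero vector space over the field ℤ/p, so it has a functional that does not vanish
  -- on the class of `x`.
  let S : AddSubgroup M := (nsmulAddMonoidHom (α := M) p).range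
  have hS : ∀ q : M ⧸ S, p • q = 0 := by
    intro q
    obtain ⟨x, rfl⟩ := QuotientAddGroup.mk_surjective q
    rw [← QuotientAddGroup.mk_nsmul, QuotientAddGroup.eq_zero_iff]
    exact ⟨x, rfl⟩
  unfold IsDivisibleBy at h
  push Not at h
  obtain ⟨x, hx⟩ := h
  have hx0 : (QuotientAddGroup.mk x : M ⧸ S) ≠ 0 := by
    rw [Ne, QuotientAddGroup.eq_zero_iff]
    rintro ⟨y, hy⟩
    exact hx y hy
  obtain ⟨f, hf⟩ := exists_addMonoidHom_zmod_ne_zero hS hx0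
  let g : M →ₗ[ℤ] ZMod p := (f.comp (QuotientAddGroup.mk' S)).toIntLinearMap
  refine ⟨g, fun a => ?_⟩
  have hgx : g x ≠ 0 := hf
  obtain ⟨k, hk⟩ := ZMod.intCast_surjective (a * (g x)⁻¹)
  refine ⟨k • x, ?_⟩
  rw [map_zsmul, zsmul_eq_mul, hk, inv_mul_cancel_right₀ hgx]

/-- A nonzero torsion-free quotient of `M` survives in the tensor product with a group having an
element of infinite order. -/
lemma allTorsion_or_of_subsingleton_tensor [Subsingleton (M ⊗[ℤ] N)] :
    AllTorsion M ∨ AllTorsion N := by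
  by_contra! h
  obtain ⟨h1, h2⟩ := h
  unfold AllTorsion at h1
  push Not at h1
  obtain ⟨x, hx⟩ := h1
  -- `F` is torsion-free, hence flat. If `x` has infinite order, ℤ → `M` at `x` stays injective
  -- after ⊗ `F`, so `F` embeds in M ⊗ F = 0.
  let F := N ⧸ Submodule.torsion ℤ N
  have : Subsingleton (M ⊗[ℤ] F) :=
    (LinearMap.lTensor_surjective M (Submodule.torsion ℤ N).mkQ_surjective).subsingleton
  have hi : Function.Injective (LinearMap.toSpanSingleton ℤ M x) := by
    refine (injective_iff_map_eq_zero _).2 fun a ha => ?_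
    by_contra ha0
    refine hx a.natAbs (Int.natAbs_pos.2 ha0) ?_
    have ha' : a • x = 0 := by simpa using ha
    exact natAbs_nsmul_eq_zero.2 ha'
  have : Subsingleton (ℤ ⊗[ℤ] F) :=
    (Module.Flat.rTensor_preserves_injective_linearMap (M := F) _ hi).subsingleton
  have : Subsingleton F := (TensorProduct.lid ℤ F).symm.injective.subsingleton
  apply h2
  intro y
  have hy : Submodule.Quotient.mk (p := Submodule.torsion ℤ N) y = 0 :=
    Subsingleton.elim (α := F) _ _
  rw [Submodule.Quotient.mk_eq_zero, Submodule.mem_torsion_iff] at hy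
  obtain ⟨a, ha⟩ := hy
  have ha0 : (a : ℤ) ≠ 0 := nonZeroDivisors.coe_ne_zero a
  refine ⟨(a : ℤ).natAbs, Int.natAbs_pos.2 ha0, ?_⟩
  have ha' : (a : ℤ) • y = 0 := ha
  exact natAbs_nsmul_eq_zero.2 ha'

lemma isDivisibleBy_or_of_subsingleton_tensor [Subsingleton (M ⊗[ℤ] N)] {p : ℕ} (hp : p.Prime) :
    IsDivisibleBy M p ∨ IsDivisibleBy N p := by
  by_cases h : IsDivisibleBy N p
  · exact Or.inr h
  · obtain ⟨f, hf⟩ := exists_surjective_zmod hp h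
    have : Subsingleton (M ⊗[ℤ] ZMod p) := (LinearMap.lTensor_surjective M hf).subsingleton
    exact Or.inl isDivisibleBy_of_subsingleton_tensor_zmod

/-- Splitting an element of finite order into its `p`-primary part and a `p`-divisible part. -/
lemma exists_pow_smul_sub_eq_zero_of_smul_eq_zero {p : ℕ} (hp : p.Prime) {m : ℕ} (hm : 0 < m)
    {t : M} (ht : m • t = 0) : ∃ (y : M) (k : ℕ), p ^ k • (t - p • y) = 0 := by
  -- Write m = p^k r with r prime to p. If ar + bp = 1, then t - p(bt) = a(rt), which p^k kills.
  obtain ⟨k, r, hr, rfl⟩ := Nat.exists_eq_pow_mul_and_not_dvd hm.ne' p hp.ne_one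
  have hc : IsCoprime (r : ℤ) (p : ℤ) := by
    rw [Nat.isCoprime_iff_coprime]
    exact ((Nat.Prime.coprime_iff_not_dvd hp).2 hr).symm
  obtain ⟨a, b, hab⟩ := hc
  refine ⟨b • t, k, ?_⟩
  have e : t - p • b • t = a • (r • t) := by
    have h1 : t = (a * r + b * p) • t := by rw [hab, one_smul]
    rw [← natCast_zsmul (b • t), ← natCast_zsmul t r, smul_smul, smul_smul, sub_eq_iff_eq_add,
      ← add_smul, mul_comm (p : ℤ) b]
    exact h1
  rw [e, smul_comm, smul_smul, ht, smul_zero]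

/-- An element of order p embeds ℤ/p in `M`. Since N/Tor(N) is flat, it has zero tensor product with
ℤ/p, hence is p-divisible. The remaining torsion error is p-divisible up to p-primary torsion. -/
lemma noTorsionBy_or_of_subsingleton_tensor [Subsingleton (M ⊗[ℤ] N)] {p : ℕ} (hp : p.Prime) :
    NoTorsionBy M p ∨ IsDivisibleModTorsion N p := by
  by_cases h : NoTorsionBy M p
  · exact Or.inl h
  right
  unfold NoTorsionBy at h
  push Not at h
  obtain ⟨x, hx, hx0⟩ := h
  let F := N ⧸ Submodule.torsion ℤ N
  have : Subsingleton (M ⊗[ℤ] F) :=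
    (LinearMap.lTensor_surjective M (Submodule.torsion ℤ N).mkQ_surjective).subsingleton
  obtain ⟨f, -, hf⟩ := exists_injective_zmod_linearMap hp x hx hx0
  have : Subsingleton (ZMod p ⊗[ℤ] F) :=
    (Module.Flat.rTensor_preserves_injective_linearMap (M := F) _ hf).subsingleton
  have : Subsingleton (F ⊗[ℤ] ZMod p) := (TensorProduct.comm ℤ F (ZMod p)).injective.subsingleton
  have hF : IsDivisibleBy F p := isDivisibleBy_of_subsingleton_tensor_zmod
  intro g
  obtain ⟨q, hq⟩ := hF (Submodule.Quotient.mk g)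
  obtain ⟨y, rfl⟩ := Submodule.Quotient.mk_surjective _ q
  have ht : g - p • y ∈ Submodule.torsion ℤ N := by
    rw [← Submodule.Quotient.mk_eq_zero, Submodule.Quotient.mk_sub, ← hq, sub_eq_zero]
    rfl
  rw [Submodule.mem_torsion_iff] at ht
  obtain ⟨a, ha⟩ := ht
  have ha' : (a : ℤ) • (g - p • y) = 0 := ha
  have ha0 : (a : ℤ) ≠ 0 := nonZeroDivisors.coe_ne_zero a
  have hn : (a : ℤ).natAbs • (g - p • y) = 0 := by
    exact natAbs_nsmul_eq_zero.2 ha'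
  obtain ⟨z, k, hz⟩ := exists_pow_smul_sub_eq_zero_of_smul_eq_zero hp (Int.natAbs_pos.2 ha0) hn
  exact ⟨y + z, k, by rw [smul_add, ← sub_sub]; exact hz⟩

/-- Elementwise conditions equivalent to the vanishing of `M ⊗ N`. -/
structure TensorVanishing (M N : Type*) [AddCommGroup M] [AddCommGroup N] : Prop where
  divisible : ∀ p : ℕ, p.Prime → IsDivisibleBy M p ∨ IsDivisibleBy N p
  torsion : AllTorsion M ∨ AllTorsion N
  left : ∀ p : ℕ, p.Prime → NoTorsionBy M p ∨ IsDivisibleModTorsion N p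
  right : ∀ p : ℕ, p.Prime → NoTorsionBy N p ∨ IsDivisibleModTorsion M p

lemma TensorVanishing.symm (h : TensorVanishing M N) : TensorVanishing N M :=
  ⟨fun p hp => (h.divisible p hp).symm, h.torsion.symm, h.right, h.left⟩

lemma nsmul_tmul_comm (n : ℕ) (x : M) (g : N) : (n • x) ⊗ₜ[ℤ] g = x ⊗ₜ[ℤ] (n • g) := by
  rw [← natCast_zsmul, ← natCast_zsmul, TensorProduct.smul_tmul]

/-- Induction on the order of `g`: coprime factors are separated by Bézout, so the substance is the
prime power case. -/
lemma TensorVanishing.tmul_eq_zero (h : TensorVanishing M N) {m : ℕ} (hm : 0 < m) :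
    ∀ g : N, m • g = 0 → ∀ x : M, x ⊗ₜ[ℤ] g = 0 := by
  induction m using Nat.recOnPosPrimePosCoprime with
  | zero => omega
  | one =>
    intro g hg x
    rw [one_smul] at hg
    rw [hg, TensorProduct.tmul_zero]
  | prime_pow p n hp hn =>
    intro g hg x
    by_cases hN : NoTorsionBy N p
    · have h0 : ∀ k : ℕ, ∀ g : N, p ^ k • g = 0 → g = 0 := by
        intro k
        induction k with
        | zero => intro g hg; simpa using hg
        | succ k ih => intro g hg; exact hN _ (ih _ (by rw [smul_smul, ← pow_succ, hg]))
      rw [h0 n g hg, TensorProduct.tmul_zero]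
    · have hM := (h.right p hp).resolve_left hN
      -- The part p^n y of `x` pairs to zero with `g`, leaving an element killed by p^k. Whichever
      -- factor is p-divisible then lets a power of p cross the tensor sign and kill the other side.
      obtain ⟨y, k, hy⟩ := hM.pow n x
      rw [← sub_add_cancel x (p ^ n • y), TensorProduct.add_tmul, nsmul_tmul_comm, hg,
        TensorProduct.tmul_zero, add_zero]
      rcases h.divisible p hp with hd | hd
      · obtain ⟨z, hz⟩ := hd.pow n (x - p ^ n • y)
        rw [← hz, nsmul_tmul_comm, hg, TensorProduct.tmul_zero]
      · obtain ⟨z, hz⟩ := hd.pow k g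
        rw [← hz, ← nsmul_tmul_comm, hy, TensorProduct.zero_tmul]
  | coprime a b ha hb hab iha ihb =>
    intro g hg x
    obtain ⟨u, v, huv⟩ := Nat.isCoprime_iff_coprime.2 hab
    have e : g = u • (a • g) + v • (b • g) := by
      rw [← natCast_zsmul g a, ← natCast_zsmul g b, smul_smul, smul_smul, ← add_smul, huv,
        one_smul]
    rw [e, TensorProduct.tmul_add, TensorProduct.tmul_smul u, TensorProduct.tmul_smul v,
      ihb (by omega) (a • g) (by rw [smul_smul, mul_comm, hg]) x,
      iha (by omega) (b • g) (by rw [smul_smul, hg]) x, smul_zero, smul_zero, add_zero]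

lemma TensorVanishing.subsingleton_of_allTorsion (h : TensorVanishing M N) (hN : AllTorsion N) :
    Subsingleton (M ⊗[ℤ] N) := by
  refine subsingleton_of_forall_eq 0 fun t => ?_
  induction t with
  | zero => rfl
  | add a b ha hb => rw [ha, hb, add_zero]
  | tmul x g =>
    obtain ⟨m, hm, hg⟩ := hN g
    exact h.tmul_eq_zero hm g hg x

/-- The tensor product of two abelian groups vanishes exactly under the conditions of
`TensorVanishing`. -/
theorem subsingleton_tensor_iff : Subsingleton (M ⊗[ℤ] N) ↔ TensorVanishing M N := by
  constructor
  · intro h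
    have : Subsingleton (N ⊗[ℤ] M) := (TensorProduct.comm ℤ N M).injective.subsingleton
    exact ⟨fun p hp => isDivisibleBy_or_of_subsingleton_tensor hp,
      allTorsion_or_of_subsingleton_tensor,
      fun p hp => noTorsionBy_or_of_subsingleton_tensor hp,
      fun p hp => noTorsionBy_or_of_subsingleton_tensor hp⟩
  · intro h
    rcases h.torsion with hM | hN
    · have := h.symm.subsingleton_of_allTorsion hM
      exact (TensorProduct.comm ℤ M N).injective.subsingleton
    · exact h.subsingleton_of_allTorsion hN

end TensorVanishing
end Bockstein

namespace Bockstein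

open scoped TensorProduct

/-! ### Vanishing of Tor, as injectivity of B ⊗ G → Z ⊗ G -/

section TorVanishing

variable {Z : Type*} [AddCommGroup Z] {G : Type*} [AddCommGroup G]

lemma NoTorsionBy.pow {M : Type*} [AddCommGroup M] {p : ℕ} (h : NoTorsionBy M p) (k : ℕ) :
    NoTorsionBy M (p ^ k) := by
  induction k with
  | zero => intro g hg; simpa using hg
  | succ k ih => intro g hg; exact h _ (ih _ (by rw [smul_smul, ← pow_succ, hg]))

lemma NoTorsionBy.of_injective {M N : Type*} [AddCommGroup M] [AddCommGroup N] {p : ℕ}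
    (h : NoTorsionBy N p) (f : M →+ N) (hf : Function.Injective f) : NoTorsionBy M p :=
  fun x hx => hf (by rw [map_zero]; exact h _ (by rw [← map_nsmul, hx, map_zero]))

/-- If pg = 0 and pz ∈ B, then pz ⊗ g vanishes in Z ⊗ G, hence in B ⊗ G. As `B` is flat, pz ⊗ 1
vanishes in B ⊗ ℤ/p, so pz = pb with b ∈ B, and z = b since `Z` is torsion-free. -/
lemma noTorsionBy_quotient_of_injective_rTensor [Module.Flat ℤ Z] (B : Submodule ℤ Z)
    (h : Function.Injective (B.subtype.rTensor G)) {p : ℕ} (hp : p.Prime) :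
    NoTorsionBy G p ∨ NoTorsionBy (Z ⧸ B) p := by
  by_cases hG : NoTorsionBy G p
  · exact Or.inl hG
  right
  unfold NoTorsionBy at hG
  push Not at hG
  obtain ⟨g, hg, hg0⟩ := hG
  intro q hq
  obtain ⟨z, rfl⟩ := Submodule.Quotient.mk_surjective _ q
  have hz : p • z ∈ B := by
    rw [← Submodule.Quotient.mk_eq_zero]
    exact hq
  have h1 : (⟨p • z, hz⟩ : B) ⊗ₜ[ℤ] g = 0 := by
    apply h
    rw [LinearMap.rTensor_tmul, map_zero, Submodule.subtype_apply, nsmul_tmul_comm, hg,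
      TensorProduct.tmul_zero]
  obtain ⟨f, hf1, hf⟩ := exists_injective_zmod_linearMap hp g hg hg0
  have h2 : (⟨p • z, hz⟩ : B) ⊗ₜ[ℤ] (1 : ZMod p) = 0 := by
    apply Module.Flat.lTensor_preserves_injective_linearMap (M := B) f hf
    rw [LinearMap.lTensor_tmul, hf1, h1, map_zero]
  obtain ⟨b, hb⟩ := exists_smul_eq_of_tmul_one_eq_zero p _ h2
  have hb' : p • (b : Z) = p • z := congrArg Subtype.val hb
  have hzb : (b : Z) = z := by
    rw [← natCast_zsmul, ← natCast_zsmul z] at hb'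
    exact smul_right_injective Z (Int.natCast_ne_zero.2 hp.ne_zero) hb'
  rw [Submodule.Quotient.mk_eq_zero, ← hzb]
  exact b.2

/-- Every tensor is b ⊗ 1. If it dies in Z ⊗ ℤ/n then b = nz, the hypothesis puts z in `B`, and b ⊗
1 = z ⊗ n = 0. -/
lemma injective_rTensor_zmod (B : Submodule ℤ Z) [Module.Flat ℤ Z] {n : ℕ}
    (h : NoTorsionBy (Z ⧸ B) n) : Function.Injective (B.subtype.rTensor (ZMod n)) := by
  have hone : ∀ t : B ⊗[ℤ] ZMod n, ∃ b : B, t = b ⊗ₜ 1 := by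
    intro t
    induction t with
    | zero => exact ⟨0, by simp⟩
    | add x y hx hy =>
      obtain ⟨a, rfl⟩ := hx
      obtain ⟨b, rfl⟩ := hy
      exact ⟨a + b, (TensorProduct.add_tmul _ _ _).symm⟩
    | tmul b c =>
      obtain ⟨k, rfl⟩ := ZMod.intCast_surjective c
      refine ⟨k • b, ?_⟩
      rw [TensorProduct.smul_tmul, zsmul_one]
  refine (injective_iff_map_eq_zero _).2 fun t ht => ?_
  obtain ⟨b, rfl⟩ := hone t
  obtain ⟨z, hz⟩ := exists_smul_eq_of_tmul_one_eq_zero n (b : Z) ht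
  have hzB : z ∈ B := by
    rw [← Submodule.Quotient.mk_eq_zero]
    apply h
    change Submodule.Quotient.mk (n • z) = 0
    rw [hz, Submodule.Quotient.mk_eq_zero]
    exact b.2
  have hb : b = n • ⟨z, hzB⟩ := Subtype.ext hz.symm
  rw [hb, nsmul_tmul_comm]
  simp

/-- Injectivity of `f ⊗ N` can be tested after applying a jointly injective family. -/
lemma injective_rTensor_of_jointly {B : Type*} [AddCommGroup B] (f : B →ₗ[ℤ] Z) {ι : Type*}
    {N : Type*} [AddCommGroup N]
    {N' : ι → Type*} [∀ i, AddCommGroup (N' i)] (π : ∀ i, N →ₗ[ℤ] N' i)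
    (hπ : ∀ t : B ⊗[ℤ] N, (∀ i, (π i).lTensor B t = 0) → t = 0)
    (h : ∀ i, Function.Injective (f.rTensor (N' i))) : Function.Injective (f.rTensor N) := by
  refine (injective_iff_map_eq_zero _).2 fun t ht => hπ t fun i => h i ?_
  rw [map_zero, ← LinearMap.comp_apply, LinearMap.rTensor_comp_lTensor,
    ← LinearMap.lTensor_comp_rTensor, LinearMap.comp_apply, ht, map_zero]

lemma injective_rTensor_directSum {B : Type*} [AddCommGroup B] (f : B →ₗ[ℤ] Z) {ι : Type*}
    [DecidableEq ι] (N : ι → Type*) [∀ i, AddCommGroup (N i)]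
    (h : ∀ i, Function.Injective (f.rTensor (N i))) :
    Function.Injective (f.rTensor (DirectSum ι N)) := by
  refine injective_rTensor_of_jointly f (DirectSum.component ℤ ι N) (fun t ht => ?_) h
  apply (TensorProduct.directSumRight ℤ ℤ B N).injective
  rw [map_zero]
  refine DFinsupp.ext fun i => ?_
  have key : ∀ t : B ⊗[ℤ] DirectSum ι N, TensorProduct.directSumRight ℤ ℤ B N t i =
      (DirectSum.component ℤ ι N i).lTensor B t := by
    intro t
    induction t with
    | zero => simp
    | add x y hx hy => simp only [map_add, DirectSum.add_apply, hx, hy]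
    | tmul b x => exact TensorProduct.directSumRight_tmul ..
  rw [key, ht i]
  rfl

lemma injective_rTensor_prod {B : Type*} [AddCommGroup B] (f : B →ₗ[ℤ] Z)
    (N N' : Type*) [AddCommGroup N] [AddCommGroup N'] (h : Function.Injective (f.rTensor N))
    (h' : Function.Injective (f.rTensor N')) : Function.Injective (f.rTensor (N × N')) := by
  refine (injective_iff_map_eq_zero _).2 fun t ht => ?_
  apply (TensorProduct.prodRight ℤ ℤ B N N').injective
  have key : ∀ t : B ⊗[ℤ] (N × N'), TensorProduct.prodRight ℤ ℤ B N N' t =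
      ((LinearMap.fst ℤ N N').lTensor B t, (LinearMap.snd ℤ N N').lTensor B t) := by
    intro t
    induction t with
    | zero => simp only [map_zero, Prod.mk_zero_zero]
    | add x y hx hy => simp only [map_add, hx, hy, Prod.mk_add_mk]
    | tmul b x => simp
  rw [key, map_zero]
  refine Prod.ext (h ?_) (h' ?_)
  · rw [Prod.fst_zero, map_zero, ← LinearMap.comp_apply, LinearMap.rTensor_comp_lTensor,
      ← LinearMap.lTensor_comp_rTensor, LinearMap.comp_apply, ht, map_zero]
  · rw [Prod.snd_zero, map_zero, ← LinearMap.comp_apply, LinearMap.rTensor_comp_lTensor,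
      ← LinearMap.lTensor_comp_rTensor, LinearMap.comp_apply, ht, map_zero]

lemma injective_rTensor_of_equiv {B : Type*} [AddCommGroup B] (f : B →ₗ[ℤ] Z)
    {N N' : Type*} [AddCommGroup N] [AddCommGroup N'] (e : N ≃ₗ[ℤ] N')
    (h : Function.Injective (f.rTensor N')) : Function.Injective (f.rTensor N) :=
  injective_rTensor_of_jointly f (fun _ : Unit => e.toLinearMap)
    (fun _ ht => (e.lTensor B).injective ((ht ()).trans (map_zero _).symm)) fun _ => h

lemma injective_rTensor_of_fg (B : Submodule ℤ Z) [Module.Flat ℤ Z] [AddGroup.FG G]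
    (h : ∀ p : ℕ, p.Prime → NoTorsionBy G p ∨ NoTorsionBy (Z ⧸ B) p) :
    Function.Injective (B.subtype.rTensor G) := by
  obtain ⟨n, ι, _, p, hp, e, ⟨φ⟩⟩ := AddCommGroup.equiv_free_prod_directSum_zmod G
  classical
  refine injective_rTensor_of_equiv _ φ.toIntLinearEquiv
    (injective_rTensor_prod _ _ _
      (Module.Flat.rTensor_preserves_injective_linearMap _ B.subtype_injective)
      (injective_rTensor_directSum _ _ fun i => ?_))
  apply injective_rTensor_zmod B
  rcases h (p i) (hp i) with hG | hG
  -- The decomposition allows exponent 0. A summand embedded in a group without p-torsion must be of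
  -- this trivial kind.
  · have h0 : NoTorsionBy (ZMod (p i ^ e i)) (p i) := by
      let j : ZMod (p i ^ e i) →+ G := φ.symm.toAddMonoidHom.comp
        ((AddMonoidHom.inr (Fin n →₀ ℤ) _).comp
          (DirectSum.of (fun i => ZMod (p i ^ e i)) i))
      exact hG.of_injective j (φ.symm.injective.comp
        ((Prod.mk_right_injective 0).comp (DirectSum.of_injective i)))
    have h1 : (1 : ZMod (p i ^ e i)) = 0 := h0.pow (e i) 1 (by simp)
    have : Subsingleton (ZMod (p i ^ e i)) := subsingleton_of_zero_eq_one h1.symm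
    have he : p i ^ e i = 1 := by
      rwa [ZMod.subsingleton_iff] at this
    rw [he]
    intro x hx
    simpa using hx
  · exact hG.pow _

/-- For `B ≤ Z` with `Z` torsion-free, vanishing of `Tor (Z / B) G` (injectivity of
`B ⊗ G → Z ⊗ G`) is detected by elements of prime order. -/
theorem injective_rTensor_iff (B : Submodule ℤ Z) [Module.Flat ℤ Z] :
    Function.Injective (B.subtype.rTensor G) ↔
      ∀ p : ℕ, p.Prime → NoTorsionBy G p ∨ NoTorsionBy (Z ⧸ B) p := by
  refine ⟨fun h p hp => noTorsionBy_quotient_of_injective_rTensor B h hp, fun h => ?_⟩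
  refine (injective_iff_map_eq_zero _).2 fun t ht => ?_
  -- Reduction to finitely generated coefficients: `t` comes from some B ⊗ N, and flatness of `Z`
  -- makes Z ⊗ N → Z ⊗ G injective.
  obtain ⟨N, hN, hts⟩ := TensorProduct.exists_finite_submodule_right_of_setFinite {t}
    (Set.finite_singleton t)
  obtain ⟨s, hs⟩ := hts rfl
  have : AddGroup.FG N := Module.Finite.iff_addGroup_fg.1 hN
  have hinj : Function.Injective (B.subtype.rTensor N) := injective_rTensor_of_fg B fun p hp =>
    (h p hp).imp_left fun hG => hG.of_injective N.subtype.toAddMonoidHom N.subtype_injective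
  have hs0 : s = 0 := by
    apply hinj
    apply Module.Flat.lTensor_preserves_injective_linearMap (M := Z) N.subtype N.subtype_injective
    rw [← LinearMap.comp_apply, LinearMap.lTensor_comp_rTensor,
      ← LinearMap.rTensor_comp_lTensor, LinearMap.comp_apply, hs, ht, map_zero, map_zero]
  rw [← hs, hs0, map_zero]

end TorVanishing

/-! ### Universal coefficients -/

section UniversalCoefficients

variable {M₁ M₂ M₃ : Type*} [AddCommGroup M₁] [AddCommGroup M₂] [AddCommGroup M₃]
  (f : M₁ →ₗ[ℤ] M₂) (g : M₂ →ₗ[ℤ] M₃) (hfg : g ∘ₗ f = 0) (G : Type*) [AddCommGroup G]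

/-- By right exactness the cokernel of f ⊗ G is coker(f) ⊗ G, so exactness in the middle is
injectivity of the map induced on it. -/
lemma exact_rTensor_iff_injective :
    Function.Exact (f.rTensor G) (g.rTensor G) ↔
      Function.Injective (((LinearMap.range f).liftQ g
        (LinearMap.range_le_ker_iff.2 hfg)).rTensor G) := by
  set g' := (LinearMap.range f).liftQ g (LinearMap.range_le_ker_iff.2 hfg)
  have hex : Function.Exact (f.rTensor G) ((LinearMap.range f).mkQ.rTensor G) :=
    rTensor_exact G (LinearMap.exact_map_mkQ_range f) (LinearMap.range f).mkQ_surjective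
  have hg : ∀ m, g.rTensor G m = g'.rTensor G ((LinearMap.range f).mkQ.rTensor G m) := by
    intro m
    rw [← LinearMap.comp_apply, ← LinearMap.rTensor_comp, Submodule.liftQ_mkQ]
  constructor
  · intro h
    refine (injective_iff_map_eq_zero _).2 fun q hq => ?_
    obtain ⟨m, rfl⟩ := LinearMap.rTensor_surjective G (LinearMap.range f).mkQ_surjective q
    rw [← hg] at hq
    exact (hex m).2 ((h m).1 hq)
  · intro h m
    rw [← hex m, hg]
    exact map_eq_zero_iff _ h

/-- The image of `g` lies in a flat module, so it is flat and the sequence ker g → M₂ → range g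
stays short exact after ⊗ `G`. Applied to the map induced on coker f, the kernel is the homology. -/
lemma injective_rTensor_iff_subsingleton [Module.Flat ℤ M₃] :
    Function.Injective (g.rTensor G) ↔ Subsingleton (LinearMap.ker g ⊗[ℤ] G) ∧
      Function.Injective ((LinearMap.range g).subtype.rTensor G) := by
  have hcomp : g.rTensor G = (LinearMap.range g).subtype.rTensor G ∘ₗ g.rangeRestrict.rTensor G := by
    rw [← LinearMap.rTensor_comp, LinearMap.subtype_comp_codRestrict]
  have hsurj : Function.Surjective (g.rangeRestrict.rTensor G) :=
    LinearMap.rTensor_surjective G g.surjective_rangeRestrict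
  have hker : Function.Exact (LinearMap.ker g).subtype g.rangeRestrict := by
    intro x
    rw [← LinearMap.mem_ker, LinearMap.ker_rangeRestrict, Submodule.coe_subtype,
      Subtype.range_coe]
    rfl
  have hex : Function.Exact ((LinearMap.ker g).subtype.rTensor G) (g.rangeRestrict.rTensor G) :=
    rTensor_exact G hker g.surjective_rangeRestrict
  have hl := LinearMap.lTensor_injective_of_exact_of_flat g.rangeRestrict
    g.surjective_rangeRestrict (LinearMap.ker g).subtype (LinearMap.ker g).subtype_injective hker G
  have hi : Function.Injective ((LinearMap.ker g).subtype.rTensor G) := by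
    rw [← LinearMap.comm_comp_lTensor_comp_comm_eq]
    exact (TensorProduct.comm ..).injective.comp (hl.comp (TensorProduct.comm ..).injective)
  have hss : Function.Injective (g.rangeRestrict.rTensor G) ↔
      Subsingleton (LinearMap.ker g ⊗[ℤ] G) := by
    constructor
    · intro h
      refine subsingleton_of_forall_eq 0 fun t => hi (h ?_)
      rw [hex.apply_apply_eq_zero, map_zero, map_zero]
    · intro _
      refine (injective_iff_map_eq_zero _).2 fun t ht => ?_
      obtain ⟨s, rfl⟩ := (hex t).1 ht
      rw [Subsingleton.elim s 0, map_zero]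
  rw [← hss, hcomp]
  constructor
  · intro h
    have h1 : Function.Injective (g.rangeRestrict.rTensor G) := Function.Injective.of_comp h
    exact ⟨h1, Function.Injective.of_comp_right h hsurj⟩
  · rintro ⟨h1, h2⟩
    exact h2.comp h1

/-- Universal coefficients, as a vanishing criterion: exactness of `M₁ ⊗ G → M₂ ⊗ G → M₃ ⊗ G`
depends on a tensor condition on the homology and on a torsion condition on the cokernel. -/
theorem exact_rTensor_iff [Module.Flat ℤ M₃] :
    Function.Exact (f.rTensor G) (g.rTensor G) ↔
      TensorVanishing (LinearMap.ker ((LinearMap.range f).liftQ g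
        (LinearMap.range_le_ker_iff.2 hfg))) G ∧
      ∀ p : ℕ, p.Prime → NoTorsionBy G p ∨
        NoTorsionBy (M₃ ⧸ LinearMap.range ((LinearMap.range f).liftQ g
          (LinearMap.range_le_ker_iff.2 hfg))) p := by
  rw [exact_rTensor_iff_injective f g hfg, injective_rTensor_iff_subsingleton,
    subsingleton_tensor_iff, injective_rTensor_iff]

end UniversalCoefficients
end Bockstein

namespace Bockstein

/-! ### What each Bockstein group detects -/

section BocksteinGroups

/-- Any denominator prime to p suffices, reduced or not; this avoids computing lowest terms. -/
lemma mem_localRat_iff (p : Nat.Primes) (q : ℚ) :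
    q ∈ localRat p ↔ ∃ (a : ℤ) (d : ℕ), ¬ (p : ℕ) ∣ d ∧ (d : ℚ) * q = a := by
  constructor
  · intro h
    exact ⟨q.num, q.den, h, Rat.den_mul_eq_num q⟩
  · rintro ⟨a, d, hd, h⟩ hp
    apply hd
    have hd0 : (d : ℚ) ≠ 0 := by
      rintro h0
      exact hd (by rw [Nat.cast_eq_zero.1 h0]; exact dvd_zero _)
    have hq : q = (a : ℚ) / ((d : ℤ) : ℚ) := by
      rw [eq_div_iff (by exact_mod_cast hd0), mul_comm]
      exact_mod_cast h
    have h1 := Rat.den_dvd a (d : ℤ)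
    rw [Rat.divInt_eq_div, ← hq] at h1
    exact hp.trans (Int.natCast_dvd_natCast.1 h1)

lemma mem_localRat_of_nsmul_mem {p : Nat.Primes} {l : ℕ} (hl : l.Prime) (hlp : l ≠ p) {q : ℚ}
    (h : l • q ∈ localRat p) : q ∈ localRat p := by
  rw [mem_localRat_iff] at h ⊢
  obtain ⟨a, d, hd, h⟩ := h
  refine ⟨a, d * l, fun hdvd => ?_, ?_⟩
  · rcases p.2.dvd_mul.1 hdvd with h1 | h1
    · exact hd h1
    · exact hlp ((Nat.prime_dvd_prime_iff_eq p.2 hl).1 h1).symm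
  · rw [← h, nsmul_eq_mul]; push_cast; ring

lemma inv_prime_notMem_localRat (p : Nat.Primes) : ((p : ℕ) : ℚ)⁻¹ ∉ localRat p := by
  intro h
  apply h
  rw [Rat.inv_natCast_den_of_pos p.2.pos]

lemma isDivisibleBy_rat {m : ℕ} (hm : m ≠ 0) : IsDivisibleBy ℚ m := fun q =>
  ⟨q / m, by rw [nsmul_eq_mul, mul_div_cancel₀]; exact_mod_cast hm⟩

lemma noTorsionBy_rat {m : ℕ} (hm : m ≠ 0) : NoTorsionBy ℚ m := fun _ hq =>
  (smul_eq_zero.1 hq).resolve_left hm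

lemma not_allTorsion_rat : ¬ AllTorsion ℚ := by
  intro h
  obtain ⟨m, hm, h1⟩ := h 1
  exact one_ne_zero (noTorsionBy_rat hm.ne' _ h1)

lemma isDivisibleBy_zmod {p l : ℕ} (hp : p.Prime) (hl : l.Prime) (h : l ≠ p) :
    IsDivisibleBy (ZMod p) l := fun x =>
  ⟨(l : ZMod p)⁻¹ * x, by
    rw [nsmul_eq_mul, ← mul_assoc, ZMod.coe_mul_inv_eq_one l ((Nat.coprime_primes hl hp).2 h),
      one_mul]⟩

lemma noTorsionBy_zmod {p l : ℕ} (hp : p.Prime) (hl : l.Prime) (h : l ≠ p) :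
    NoTorsionBy (ZMod p) l := by
  intro x hx
  have h1 := ZMod.coe_mul_inv_eq_one l ((Nat.coprime_primes hl hp).2 h)
  rw [nsmul_eq_mul] at hx
  rw [← one_mul x, ← h1, mul_right_comm, hx, zero_mul]

lemma not_isDivisibleBy_zmod {p : ℕ} (hp : p.Prime) : ¬ IsDivisibleBy (ZMod p) p := by
  have := Fact.mk hp
  intro h
  obtain ⟨x, hx⟩ := h 1
  simp at hx

lemma not_noTorsionBy_zmod {p : ℕ} (hp : p.Prime) : ¬ NoTorsionBy (ZMod p) p := by
  have := Fact.mk hp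
  intro h
  exact one_ne_zero (h 1 (by simp))

lemma allTorsion_zmod {p : ℕ} (hp : p.Prime) : AllTorsion (ZMod p) := fun x =>
  ⟨p, hp.pos, by simp⟩

lemma isDivisibleModTorsion_zmod (p l : ℕ) (hp : p.Prime) (hl : l.Prime) :
    IsDivisibleModTorsion (ZMod p) l := by
  by_cases h : l = p
  · subst h
    exact fun x => ⟨0, 1, by simp⟩
  · exact (isDivisibleBy_zmod hp hl h).modTorsion

lemma isDivisibleBy_quasicyclic (p : Nat.Primes) {m : ℕ} (hm : m ≠ 0) :
    IsDivisibleBy (ℚ ⧸ localRat p) m := by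
  intro q
  obtain ⟨x, rfl⟩ := QuotientAddGroup.mk_surjective q
  obtain ⟨y, rfl⟩ := isDivisibleBy_rat hm x
  exact ⟨QuotientAddGroup.mk y, rfl⟩

lemma noTorsionBy_quasicyclic (p : Nat.Primes) {l : ℕ} (hl : l.Prime) (h : l ≠ p) :
    NoTorsionBy (ℚ ⧸ localRat p) l := by
  intro q hq
  obtain ⟨x, rfl⟩ := QuotientAddGroup.mk_surjective q
  rw [← QuotientAddGroup.mk_nsmul, QuotientAddGroup.eq_zero_iff] at hq
  rw [QuotientAddGroup.eq_zero_iff]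
  exact mem_localRat_of_nsmul_mem hl h hq

lemma not_noTorsionBy_quasicyclic (p : Nat.Primes) : ¬ NoTorsionBy (ℚ ⧸ localRat p) (p : ℕ) := by
  intro h
  apply inv_prime_notMem_localRat p
  rw [← QuotientAddGroup.eq_zero_iff]
  apply h
  rw [← QuotientAddGroup.mk_nsmul, QuotientAddGroup.eq_zero_iff, mem_localRat_iff]
  refine ⟨1, 1, p.2.one_lt.ne' ∘ Nat.dvd_one.1, ?_⟩
  rw [nsmul_eq_mul, mul_inv_cancel₀ (by exact_mod_cast p.2.ne_zero)]
  simp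

lemma allTorsion_quasicyclic (p : Nat.Primes) : AllTorsion (ℚ ⧸ localRat p) := by
  intro q
  obtain ⟨x, rfl⟩ := QuotientAddGroup.mk_surjective q
  refine ⟨x.den, x.den_pos, ?_⟩
  rw [← QuotientAddGroup.mk_nsmul, QuotientAddGroup.eq_zero_iff, mem_localRat_iff]
  exact ⟨x.num, 1, p.2.one_lt.ne' ∘ Nat.dvd_one.1, by simp⟩

lemma noTorsionBy_localRat (p : Nat.Primes) {m : ℕ} (hm : m ≠ 0) : NoTorsionBy (localRat p) m :=
  (noTorsionBy_rat hm).of_injective (localRat p).subtype Subtype.val_injective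

lemma not_allTorsion_localRat (p : Nat.Primes) : ¬ AllTorsion (localRat p) := by
  intro h
  have h1 : (1 : ℚ) ∈ localRat p :=
    (mem_localRat_iff p 1).2 ⟨1, 1, p.2.one_lt.ne' ∘ Nat.dvd_one.1, by simp⟩
  obtain ⟨m, hm, h2⟩ := h ⟨1, h1⟩
  exact one_ne_zero (congrArg Subtype.val (noTorsionBy_localRat p hm.ne' _ h2))

lemma isDivisibleBy_localRat (p : Nat.Primes) {l : ℕ} (hl : l.Prime) (h : l ≠ p) :
    IsDivisibleBy (localRat p) l := by
  rintro ⟨x, hx⟩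
  obtain ⟨y, rfl⟩ := isDivisibleBy_rat hl.ne_zero x
  exact ⟨⟨y, mem_localRat_of_nsmul_mem hl h hx⟩, rfl⟩

/-- R_p is torsion-free, so dividing 1 by p modulo torsion would put 1/p in R_p. -/
lemma not_isDivisibleModTorsion_localRat (p : Nat.Primes) :
    ¬ IsDivisibleModTorsion (localRat p) (p : ℕ) := by
  intro h
  have h1 : (1 : ℚ) ∈ localRat p :=
    (mem_localRat_iff p 1).2 ⟨1, 1, p.2.one_lt.ne' ∘ Nat.dvd_one.1, by simp⟩
  obtain ⟨⟨y, hy⟩, k, hk⟩ := h ⟨1, h1⟩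
  have h2 := congrArg Subtype.val
    (noTorsionBy_localRat p (pow_ne_zero k p.2.ne_zero) _ hk)
  have h3 : 1 - ((p : ℕ) : ℚ) * y = 0 := by simpa using h2
  apply inv_prime_notMem_localRat p
  rwa [inv_eq_of_mul_eq_one_right (sub_eq_zero.1 h3).symm]

variable {H : Type*} [AddCommGroup H]

lemma AllTorsion.isDivisibleModTorsion (h : AllTorsion H) {p : ℕ} (hp : p.Prime) :
    IsDivisibleModTorsion H p := fun x => by
  obtain ⟨m, hm, hx⟩ := h x
  exact exists_pow_smul_sub_eq_zero_of_smul_eq_zero hp hm hx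

lemma tensorVanishing_rat_iff : TensorVanishing H ℚ ↔ AllTorsion H := by
  constructor
  · exact fun h => h.torsion.resolve_right not_allTorsion_rat
  · exact fun h => ⟨fun p hp => .inr (isDivisibleBy_rat hp.ne_zero), .inl h,
      fun p hp => .inr (isDivisibleBy_rat hp.ne_zero).modTorsion,
      fun p hp => .inl (noTorsionBy_rat hp.ne_zero)⟩

/-- Away from p the group ℤ/p is divisible and torsion-free, so only the clauses at p constrain `H`,
and p-divisibility implies the others. -/
lemma tensorVanishing_zmod_iff {p : ℕ} (hp : p.Prime) :
    TensorVanishing H (ZMod p) ↔ IsDivisibleBy H p := by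
  constructor
  · exact fun h => (h.divisible p hp).resolve_right (not_isDivisibleBy_zmod hp)
  · refine fun h => ⟨fun l hl => ?_, .inr (allTorsion_zmod hp),
      fun l hl => .inr (isDivisibleModTorsion_zmod p l hp hl), fun l hl => ?_⟩
    all_goals by_cases hlp : l = p
    · exact .inl (hlp ▸ h)
    · exact .inr (isDivisibleBy_zmod hp hl hlp)
    · exact .inr (hlp ▸ h.modTorsion)
    · exact .inl (noTorsionBy_zmod hp hl hlp)

lemma tensorVanishing_quasicyclic_iff (p : Nat.Primes) :
    TensorVanishing H (ℚ ⧸ localRat p) ↔ IsDivisibleModTorsion H (p : ℕ) := by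
  constructor
  · exact fun h => (h.right p p.2).resolve_left (not_noTorsionBy_quasicyclic p)
  · refine fun h => ⟨fun l hl => .inr (isDivisibleBy_quasicyclic p hl.ne_zero),
      .inr (allTorsion_quasicyclic p),
      fun l hl => .inr (isDivisibleBy_quasicyclic p hl.ne_zero).modTorsion, fun l hl => ?_⟩
    by_cases hlp : l = p
    · exact .inr (hlp ▸ h)
    · exact .inl (noTorsionBy_quasicyclic p hl hlp)

lemma tensorVanishing_localRat_iff (p : Nat.Primes) :
    TensorVanishing H (localRat p) ↔
      IsDivisibleBy H (p : ℕ) ∧ NoTorsionBy H (p : ℕ) ∧ AllTorsion H := by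
  constructor
  · exact fun h => ⟨(h.divisible p p.2).resolve_right
      fun h' => not_isDivisibleModTorsion_localRat p h'.modTorsion,
      (h.left p p.2).resolve_right (not_isDivisibleModTorsion_localRat p),
      h.torsion.resolve_right (not_allTorsion_localRat p)⟩
  · rintro ⟨h1, h2, h3⟩
    refine ⟨fun l hl => ?_, .inl h3, fun l hl => ?_,
      fun l hl => .inl (noTorsionBy_localRat p hl.ne_zero)⟩
    all_goals by_cases hlp : l = p
    · exact .inl (hlp ▸ h1)
    · exact .inr (isDivisibleBy_localRat p hl hlp)
    · exact .inl (hlp ▸ h2)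
    · exact .inr (isDivisibleBy_localRat p hl hlp).modTorsion

end BocksteinGroups

/-! ### Reduction from G to its Bockstein family -/

section BocksteinFamily

variable {G : Type v} [AddCommGroup G]

lemma isDivisibleBy_quotient_pTor_iff (p : Nat.Primes) :
    IsDivisibleBy (G ⧸ pTor G p) (p : ℕ) ↔ IsDivisibleModTorsion G (p : ℕ) := by
  constructor
  · intro h x
    obtain ⟨q, hq⟩ := h (QuotientAddGroup.mk x)
    obtain ⟨y, rfl⟩ := QuotientAddGroup.mk_surjective q
    rw [← QuotientAddGroup.mk_nsmul] at hq
    have hm := QuotientAddGroup.eq.1 hq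
    rw [neg_add_eq_sub, AddCommGroup.mem_primaryComponent] at hm
    obtain ⟨k, hk⟩ := hm
    exact ⟨y, k, hk⟩
  · intro h q
    obtain ⟨x, rfl⟩ := QuotientAddGroup.mk_surjective q
    obtain ⟨y, k, hk⟩ := h x
    refine ⟨QuotientAddGroup.mk y, ?_⟩
    rw [← QuotientAddGroup.mk_nsmul]
    apply QuotientAddGroup.eq.2
    rw [neg_add_eq_sub, AddCommGroup.mem_primaryComponent]
    exact ⟨k, hk⟩

lemma nontrivial_pTor_iff (p : Nat.Primes) :
    Nontrivial (pTor G p) ↔ ¬ NoTorsionBy G (p : ℕ) := by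
  rw [← not_subsingleton_iff_nontrivial, not_iff_not]
  constructor
  · intro h x hx
    have hm : x ∈ pTor G p := AddCommGroup.mem_primaryComponent.2 ⟨1, by rwa [pow_one]⟩
    exact congrArg Subtype.val (Subsingleton.elim (⟨x, hm⟩ : pTor G p) 0)
  · intro h
    refine subsingleton_of_forall_eq 0 ?_
    rintro ⟨x, hx⟩
    obtain ⟨k, hk⟩ := AddCommGroup.mem_primaryComponent.1 hx
    exact Subtype.ext (h.pow k x hk)

lemma isDivisibleBy_pTor_of_isDivisibleBy {p : Nat.Primes} (h : IsDivisibleBy G (p : ℕ)) :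
    IsDivisibleBy (pTor G p) (p : ℕ) := by
  rintro ⟨x, hx⟩
  obtain ⟨y, rfl⟩ := h x
  obtain ⟨k, hk⟩ := AddCommGroup.mem_primaryComponent.1 hx
  exact ⟨⟨y, AddCommGroup.mem_primaryComponent.2 ⟨k + 1, by rw [pow_succ, mul_smul, hk]⟩⟩, rfl⟩

/-- Divide modulo p-Tor(G), then divide the error inside p-Tor(G). -/
lemma isDivisibleBy_of_isDivisibleBy_pTor {p : Nat.Primes} (h : IsDivisibleBy (pTor G p) (p : ℕ))
    (h' : IsDivisibleModTorsion G (p : ℕ)) : IsDivisibleBy G (p : ℕ) := by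
  intro x
  obtain ⟨y, k, hk⟩ := h' x
  obtain ⟨⟨z, hz⟩, hz'⟩ := h ⟨x - (p : ℕ) • y, AddCommGroup.mem_primaryComponent.2 ⟨k, hk⟩⟩
  refine ⟨z + y, ?_⟩
  have h1 : (p : ℕ) • z = x - (p : ℕ) • y := congrArg Subtype.val hz'
  rw [smul_add, h1, sub_add_cancel]

lemma nontrivial_quotient_torsion_iff :
    Nontrivial (G ⧸ AddCommGroup.torsion G) ↔ ¬ AllTorsion G := by
  rw [← not_subsingleton_iff_nontrivial, not_iff_not, QuotientAddGroup.subsingleton_iff,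
    AddSubgroup.eq_top_iff']
  exact forall_congr' fun x => by
    rw [AddCommGroup.mem_torsion, isOfFinAddOrder_iff_nsmul_eq_zero]

lemma IsDivisibleModTorsion.isDivisibleBy_quotient_torsion {p : ℕ} (hp : p.Prime)
    (h : IsDivisibleModTorsion G p) : IsDivisibleBy (G ⧸ AddCommGroup.torsion G) p := by
  intro q
  obtain ⟨x, rfl⟩ := QuotientAddGroup.mk_surjective q
  obtain ⟨y, k, hk⟩ := h x
  refine ⟨QuotientAddGroup.mk y, ?_⟩
  rw [← QuotientAddGroup.mk_nsmul]
  apply QuotientAddGroup.eq.2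
  rw [neg_add_eq_sub, AddCommGroup.mem_torsion, isOfFinAddOrder_iff_nsmul_eq_zero]
  exact ⟨p ^ k, pow_pos hp.pos k, hk⟩

lemma isDivisible_of_forall_prime (h : ∀ p : ℕ, p.Prime → IsDivisibleBy G p) :
    IsDivisible G := by
  intro m hm
  induction m using induction_on_primes with
  | zero => omega
  | one => exact fun g => ⟨g, one_smul _ _⟩
  | prime_mul p a hp ih =>
    intro g
    obtain ⟨x, rfl⟩ := h p hp g
    obtain ⟨y, rfl⟩ := ih (Nat.pos_of_mul_pos_left hm) x
    exact ⟨y, mul_smul _ _ _⟩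

/-- Vanishing of the tensor product with `G` is detected by the Bockstein family of `G`. -/
theorem tensorVanishing_iff_forall_bocksteinFamily {H : Type*} [AddCommGroup H] :
    TensorVanishing H G ↔ ∀ L ∈ bocksteinFamily G, TensorVanishing H L.Carrier := by
  constructor
  · intro h L hL
    have key : ∀ p : Nat.Primes, ¬ IsDivisibleModTorsion G (p : ℕ) → ¬ AllTorsion G :=
      fun p h1 h2 => h1 (h2.isDivisibleModTorsion p.2)
    cases L with
    | rat =>
      exact tensorVanishing_rat_iff.2
        (h.torsion.resolve_right (nontrivial_quotient_torsion_iff.1 hL.1))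
    | cyclic p =>
      exact (tensorVanishing_zmod_iff p.2).2 ((h.divisible p p.2).resolve_right
        fun h1 => hL (isDivisibleBy_pTor_of_isDivisibleBy h1))
    | quasicyclic p =>
      exact (tensorVanishing_quasicyclic_iff p).2
        ((h.right p p.2).resolve_left ((nontrivial_pTor_iff p).1 hL.1))
    | localized p =>
      have hL' : ¬ IsDivisibleModTorsion G (p : ℕ) := fun h1 =>
        hL ((isDivisibleBy_quotient_pTor_iff p).2 h1)
      exact (tensorVanishing_localRat_iff p).2
        ⟨(h.divisible p p.2).resolve_right fun h1 => hL' h1.modTorsion,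
          (h.left p p.2).resolve_right hL', h.torsion.resolve_right (key p hL')⟩
  · intro h
    have hcyc (p : Nat.Primes) (hp : ¬ IsDivisibleBy (pTor G p) (p : ℕ)) :
        IsDivisibleBy H (p : ℕ) := (tensorVanishing_zmod_iff p.2).1 (h (.cyclic p) hp)
    have hloc (p : Nat.Primes) (hp : ¬ IsDivisibleModTorsion G (p : ℕ)) :
        IsDivisibleBy H (p : ℕ) ∧ NoTorsionBy H (p : ℕ) ∧ AllTorsion H :=
      (tensorVanishing_localRat_iff p).1
        (h (.localized p) fun h1 => hp ((isDivisibleBy_quotient_pTor_iff p).1 h1))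
    refine ⟨fun p hp => ?_, ?_, fun p hp => ?_, fun p hp => ?_⟩
    · by_contra! hn
      -- If `G` is not p-divisible, then p-Tor(G) or G/p-Tor(G) is not, so ℤ_p or R_p lies in σ(G).
      -- Either one forces `H` to be p-divisible.
      by_cases h1 : IsDivisibleBy (pTor G ⟨p, hp⟩) p
      · by_cases h2 : IsDivisibleModTorsion G p
        · exact hn.2 (isDivisibleBy_of_isDivisibleBy_pTor (p := ⟨p, hp⟩) h1 h2)
        · exact hn.1 (hloc ⟨p, hp⟩ h2).1
      · exact hn.1 (hcyc ⟨p, hp⟩ h1)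
    · by_contra! hn
      apply hn.1
      -- For non-torsion `G`, either ℚ ∈ σ(G), or G/Tor(G) fails to be divisible at some prime p and
      -- R_p ∈ σ(G). Both force `H` to be torsion.
      by_cases h1 : IsDivisible (G ⧸ AddCommGroup.torsion G)
      · exact tensorVanishing_rat_iff.1 (h .rat ⟨nontrivial_quotient_torsion_iff.2 hn.2, h1⟩)
      · obtain ⟨p, hp, h2⟩ : ∃ p : ℕ, p.Prime ∧
            ¬ IsDivisibleBy (G ⧸ AddCommGroup.torsion G) p := by
          by_contra! hc
          exact h1 (isDivisible_of_forall_prime hc)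
        exact (hloc ⟨p, hp⟩ fun h3 => h2 (h3.isDivisibleBy_quotient_torsion hp)).2.2
    · by_contra! hn
      exact hn.1 (hloc ⟨p, hp⟩ hn.2).2.1
    · by_contra! hn
      apply hn.2
      by_cases h1 : IsDivisibleBy (pTor G ⟨p, hp⟩) p
      · exact (tensorVanishing_quasicyclic_iff ⟨p, hp⟩).1
          (h (.quasicyclic ⟨p, hp⟩) ⟨(nontrivial_pTor_iff ⟨p, hp⟩).2 hn.1, h1⟩)
      · exact (hcyc ⟨p, hp⟩ h1).modTorsion

/-- Vanishing of the torsion product with `G` is detected by the Bockstein family of `G`. -/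
theorem noTorsionBy_or_iff_forall_bocksteinFamily {K : Type*} [AddCommGroup K] :
    (∀ p : ℕ, p.Prime → NoTorsionBy G p ∨ NoTorsionBy K p) ↔
      ∀ L ∈ bocksteinFamily G, ∀ p : ℕ, p.Prime →
        NoTorsionBy L.Carrier p ∨ NoTorsionBy K p := by
  constructor
  · intro h L hL l hl
    cases L with
    | rat => exact .inl (noTorsionBy_rat hl.ne_zero)
    | cyclic p =>
      by_cases hlp : l = p
      · subst hlp
        refine .inr ((h p p.2).resolve_left ?_)
        rw [← nontrivial_pTor_iff]
        by_contra hn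
        rw [not_nontrivial_iff_subsingleton] at hn
        exact hL fun g => ⟨g, Subsingleton.elim _ _⟩
      · exact .inl (noTorsionBy_zmod p.2 hl hlp)
    | quasicyclic p =>
      by_cases hlp : l = p
      · subst hlp
        exact .inr ((h p p.2).resolve_left ((nontrivial_pTor_iff p).1 hL.1))
      · exact .inl (noTorsionBy_quasicyclic p hl hlp)
    | localized p => exact .inl (noTorsionBy_localRat p hl.ne_zero)
  · intro h p hp
    by_contra! hn
    -- Since `G` has p-torsion, ℚ_p or ℤ_p lies in σ(G), and both have p-torsion.
    by_cases h1 : IsDivisibleBy (pTor G ⟨p, hp⟩) p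
    · exact hn.2 ((h (.quasicyclic ⟨p, hp⟩) ⟨(nontrivial_pTor_iff ⟨p, hp⟩).2 hn.1, h1⟩ p
        hp).resolve_left (not_noTorsionBy_quasicyclic ⟨p, hp⟩))
    · exact hn.2 ((h (.cyclic ⟨p, hp⟩) h1 p hp).resolve_left (not_noTorsionBy_zmod hp))

end BocksteinFamily
end Bockstein

noncomputable section
namespace Bockstein

open scoped TensorProduct

/-! ### Chains with coefficients as tensor products -/

section TensorFunctor

variable (R : Type) [CommRing R] (G : Type v) [AddCommGroup G] [Module R G]

/-- The functor `M ↦ M ⊗ G`, where `M` and `G` may lie in different universes. -/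
def tensorFunctor : ModuleCat.{u} R ⥤ ModuleCat.{max v u} R where
  obj M := ModuleCat.of R (M ⊗[R] G)
  map f := ModuleCat.ofHom (f.hom.rTensor G)
  map_id M := by ext : 1; exact LinearMap.rTensor_id G M
  map_comp f g := by ext : 1; exact LinearMap.rTensor_comp G g.hom f.hom

instance : (tensorFunctor.{u} R G).Additive where
  map_add {_ _ f g} := by ext : 1; exact LinearMap.rTensor_add G f.hom g.hom

/-- Right exactness carries the functor through the cokernel that defines relative chains. -/
instance : PreservesFiniteColimits (tensorFunctor.{u} R G) := by
  refine ((tensorFunctor.{u} R G).preservesFiniteColimits_tfae.out 0 3).1 fun S hS => ?_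
  have hepi := hS.epi_g
  rw [ModuleCat.epi_iff_surjective] at hepi
  have hex : Function.Exact S.f.hom S.g.hom :=
    LinearMap.exact_iff.2 hS.exact.moduleCat_range_eq_ker.symm
  constructor
  · rw [ShortComplex.moduleCat_exact_iff_range_eq_ker]
    exact (LinearMap.exact_iff.1 (rTensor_exact G hex hepi)).symm
  · rw [ModuleCat.epi_iff_surjective]
    exact LinearMap.rTensor_surjective G hepi

/-- The free module functor, with values in the universe of the given type. -/
def freeFunctor : Type u ⥤ ModuleCat.{u} R where
  obj S := ModuleCat.of R (S →₀ R)
  map f := ModuleCat.ofHom (Finsupp.lmapDomain R R f)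
  map_id S := by ext : 1; exact Finsupp.lmapDomain_id R R
  map_comp f g := by ext : 1; exact Finsupp.lmapDomain_comp R R f g

/-- The coproduct of copies of `G` indexed by `S` maps to `R[S] ⊗ G`. -/
def sigmaToTensor (S : Type u) : (∐ fun _ : S => ModuleCat.of R (ULift.{u} G)) ⟶
    ModuleCat.of R ((S →₀ R) ⊗[R] G) :=
  Sigma.desc fun s => ModuleCat.ofHom
    (TensorProduct.mk R (S →₀ R) G (Finsupp.single s 1) ∘ₗ
      (ULift.moduleEquiv : ULift.{u} G ≃ₗ[R] G).toLinearMap)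

/-- The inverse of `sigmaToTensor`. -/
def tensorToSigma (S : Type u) : ModuleCat.of R ((S →₀ R) ⊗[R] G) ⟶
    (∐ fun _ : S => ModuleCat.of R (ULift.{u} G)) :=
  ModuleCat.ofHom (TensorProduct.lift (Finsupp.lsum R fun s : S =>
    LinearMap.toSpanSingleton R _
      ((Sigma.ι (fun _ : S => ModuleCat.of R (ULift.{u} G)) s).hom ∘ₗ
        (ULift.moduleEquiv : ULift.{u} G ≃ₗ[R] G).symm.toLinearMap)))

lemma ι_sigmaToTensor_apply (S : Type u) (s : S) (g : ULift.{u} G) :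
    (sigmaToTensor R G S).hom ((Sigma.ι (fun _ : S => ModuleCat.of R (ULift.{u} G)) s).hom g) =
      (Finsupp.single s 1 : S →₀ R) ⊗ₜ[R] g.down := by
  have h : Sigma.ι (fun _ : S => ModuleCat.of R (ULift.{u} G)) s ≫ sigmaToTensor R G S = _ :=
    Sigma.ι_desc _ s
  exact congrArg (fun f => f.hom g) h

lemma tensorToSigma_tmul (S : Type u) (s : S) (g : G) :
    (tensorToSigma R G S).hom ((Finsupp.single s 1 : S →₀ R) ⊗ₜ[R] g) =
      (Sigma.ι (fun _ : S => ModuleCat.of R (ULift.{u} G)) s).hom ⟨g⟩ := by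
  change TensorProduct.lift _ (_ ⊗ₜ[R] g) = _
  rw [TensorProduct.lift.tmul, Finsupp.lsum_single, LinearMap.toSpanSingleton_apply, one_smul]
  rfl

/-- `R[S] ⊗ G` is the coproduct of copies of `G` indexed by `S`. -/
def sigmaTensorIso (S : Type u) : (∐ fun _ : S => ModuleCat.of R (ULift.{u} G)) ≅
    ModuleCat.of R ((S →₀ R) ⊗[R] G) where
  hom := sigmaToTensor R G S
  inv := tensorToSigma R G S
  hom_inv_id := by
    refine Sigma.hom_ext _ _ fun s => ?_
    ext g
    exact (congrArg (tensorToSigma R G S).hom (ι_sigmaToTensor_apply R G S s g)).trans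
      (tensorToSigma_tmul R G S s g.down)
  inv_hom_id := by
    ext : 1
    refine TensorProduct.ext (Finsupp.lhom_ext' fun s => LinearMap.ext_ring ?_)
    ext g
    exact (congrArg (sigmaToTensor R G S).hom (tensorToSigma_tmul R G S s g)).trans
      (ι_sigmaToTensor_apply R G S s ⟨g⟩)

/-- The identification `∐ G ≅ R[S] ⊗ G` is natural in the index type `S`. -/
def sigmaConstIso : sigmaConst.{u}.obj (ModuleCat.of R (ULift.{u} G)) ≅
    freeFunctor.{u} R ⋙ tensorFunctor R G :=
  NatIso.ofComponents (fun S => sigmaTensorIso R G S) fun {S S'} f => by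
    refine Sigma.hom_ext _ _ fun s => ?_
    ext g
    have h1 : Sigma.ι (fun _ : S => ModuleCat.of R (ULift.{u} G)) s ≫
        (sigmaConst.{u}.obj (ModuleCat.of R (ULift.{u} G))).map f =
        Sigma.ι (fun _ : S' => ModuleCat.of R (ULift.{u} G)) (f s) := by
      simp
    rw [← Category.assoc, h1]
    refine (ι_sigmaToTensor_apply R G S' (f s) g).trans ?_
    refine Eq.trans ?_ (congrArg ((Finsupp.lmapDomain R R f).rTensor G)
      (ι_sigmaToTensor_apply R G S s g)).symm
    rw [LinearMap.rTensor_tmul, Finsupp.lmapDomain_apply, Finsupp.mapDomain_single]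

/-- The complex of simplicial chains with coefficients in `R`, in the universe of the simplicial
set. -/
def freeChains : SSet.{u} ⥤ ChainComplex (ModuleCat.{u} R) ℕ :=
  (SimplicialObject.whiskering _ _).obj (freeFunctor R) ⋙
    AlgebraicTopology.alternatingFaceMapComplex _

/-- Chains with coefficients in `G` are chains with coefficients in `R` tensored with `G`. -/
def chainComplexIso :
    (SSet.chainComplexFunctor.{u} (ModuleCat.{max v u} R)).obj (ModuleCat.of R (ULift.{u} G)) ≅
      freeChains.{u} R ⋙ (tensorFunctor R G).mapHomologicalComplex _ :=
  Functor.isoWhiskerRight ((SimplicialObject.whiskering _ _).mapIso (sigmaConstIso R G))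
      (AlgebraicTopology.alternatingFaceMapComplex _) ≪≫
    Functor.isoWhiskerLeft ((SimplicialObject.whiskering _ _).obj (freeFunctor R))
      (eqToIso (AlgebraicTopology.map_alternatingFaceMapComplex (tensorFunctor R G)).symm)

end TensorFunctor

/-! ### Flatness of relative chains and the resulting criterion -/

section RelativeChains

variable (R : Type) [CommRing R] {Y : Type u} [TopologicalSpace Y] (B : Set Y)

/-- The map of singular simplicial sets induced by the inclusion of a subspace. -/
def singularIncl : TopCat.toSSet.{u}.obj (TopCat.of B) ⟶ TopCat.toSSet.{u}.obj (TopCat.of Y) :=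
  TopCat.toSSet.map (TopCat.ofHom ⟨(Subtype.val : B → Y), continuous_subtype_val⟩)

/-- The relative singular chain complex with coefficients in `R`. -/
def relFreeChains : ChainComplex (ModuleCat.{u} R) ℕ :=
  cokernel ((freeChains R).map (singularIncl B))

lemma singularIncl_app_injective (n : SimplexCategoryᵒᵖ) :
    Function.Injective ((singularIncl B).app n) := by
  intro s t h
  apply (TopCat.toSSetObjEquiv (TopCat.of B) n).injective
  ext x
  exact congrArg (fun σ => TopCat.toSSetObjEquiv (TopCat.of Y) n σ x) h

/-- The range consists of the chains supported in the image of `i`, and over a domain a nonzero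
scalar does not change the support. Hence the quotient is torsion-free. -/
lemma mem_range_lmapDomain_of_smul_mem {R : Type*} [CommRing R] [IsDomain R] {α β : Type*} {i : α → β} (hi : Function.Injective i)
    {x : β →₀ R} {m : R} (hm : m ≠ 0) (hx : m • x ∈ LinearMap.range (Finsupp.lmapDomain R R i)) :
    x ∈ LinearMap.range (Finsupp.lmapDomain R R i) := by
  obtain ⟨y, hy⟩ := hx
  refine ⟨x.comapDomain i hi.injOn, ?_⟩
  apply Finsupp.mapDomain_comapDomain i hi
  intro b hb
  by_contra hbi
  have h1 : (m • x) b = 0 := by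
    rw [← hy]
    exact Finsupp.mapDomain_of_notMem_range y b hbi
  rw [Finsupp.smul_apply, smul_eq_mul, mul_eq_zero] at h1
  exact (Finsupp.mem_support_iff.1 hb) (h1.resolve_left hm)

lemma flat_relFreeChains_X [IsDedekindDomain R] (n : ℕ) : Module.Flat R ((relFreeChains R B).X n) := by
  let φ := (freeChains R).map (singularIncl B)
  have hex : (ShortComplex.mk φ (cokernel.π φ) (cokernel.condition φ)).Exact :=
    ShortComplex.exact_cokernel φ
  have hexn := HomologicalComplex.exact_iff_degreewise_exact _ |>.1 hex n
  rw [ShortComplex.moduleCat_exact_iff_range_eq_ker] at hexn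
  have hepi : Epi ((cokernel.π φ).f n) := inferInstance
  rw [ModuleCat.epi_iff_surjective] at hepi
  have : Module.IsTorsionFree R ((relFreeChains R B).X n) := by
    refine Module.IsTorsionFree.of_smul_eq_zero fun m e he => ?_
    by_cases hm : m = 0
    · exact Or.inl hm
    right
    obtain ⟨x, rfl⟩ := hepi e
    have h1 : m • x ∈ LinearMap.ker ((cokernel.π φ).f n).hom :=
      LinearMap.mem_ker.2 ((map_smul _ m x).trans he)
    have h2 : LinearMap.range (Finsupp.lmapDomain R R ((singularIncl B).app _)) =
        LinearMap.ker ((cokernel.π φ).f n).hom := hexn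
    rw [← h2] at h1
    have h3 := mem_range_lmapDomain_of_smul_mem (singularIncl_app_injective B _) hm h1
    rw [h2] at h3
    exact h3
  infer_instance

/-- Relative singular chains with coefficients are integral relative chains tensored with the
coefficient group. -/
def relSingularChainsIso (G : Type v) [AddCommGroup G] :
    relSingularChains B G ≅
      ((tensorFunctor ℤ G).mapHomologicalComplex _).obj (relFreeChains ℤ B) :=
  cokernel.mapIso (singularChainsIncl B G)
      (((tensorFunctor ℤ G).mapHomologicalComplex _).map ((freeChains ℤ).map (singularIncl B)))
      ((chainComplexIso ℤ G).app _) ((chainComplexIso ℤ G).app _)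
      ((chainComplexIso ℤ G).hom.naturality (singularIncl B)) ≪≫
    (PreservesCokernel.iso ((tensorFunctor ℤ G).mapHomologicalComplex _)
      ((freeChains ℤ).map (singularIncl B))).symm

lemma exactAt_tensorFunctor_iff {ι : Type*} {c : ComplexShape ι}
    (K : HomologicalComplex (ModuleCat.{u} R) c) (k : ι) (G : Type v) [AddCommGroup G]
    [Module R G] :
    (((tensorFunctor R G).mapHomologicalComplex c).obj K).ExactAt k ↔
      Function.Exact ((K.sc k).f.hom.rTensor G) ((K.sc k).g.hom.rTensor G) := by
  rw [HomologicalComplex.exactAt_iff, ShortComplex.moduleCat_exact_iff_range_eq_ker,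
    LinearMap.exact_iff, eq_comm]
  rfl

/-- Vanishing of relative singular homology as exactness after tensoring with `G`. -/
lemma subsingleton_relSingularHomology_iff (k : ℕ) (G : Type v) [AddCommGroup G] :
    Subsingleton (relSingularHomology k B G) ↔
      Function.Exact (((relFreeChains ℤ B).sc k).f.hom.rTensor G)
        (((relFreeChains ℤ B).sc k).g.hom.rTensor G) := by
  have hiso : (relSingularChains B G).ExactAt k ↔
      (((tensorFunctor ℤ G).mapHomologicalComplex _).obj (relFreeChains ℤ B)).ExactAt k :=
    ⟨fun h => h.of_iso (relSingularChainsIso B G),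
      fun h => h.of_iso (relSingularChainsIso B G).symm⟩
  rw [relSingularHomology, ← ModuleCat.isZero_iff_subsingleton,
    ← HomologicalComplex.exactAt_iff_isZero_homology, hiso]
  exact exactAt_tensorFunctor_iff ℤ (relFreeChains ℤ B) k G

end RelativeChains

/-- Exactness after tensoring with `G` is detected by the Bockstein family of `G`. -/
theorem exact_rTensor_iff_forall_bocksteinFamily {M₁ M₂ M₃ : Type*} [AddCommGroup M₁]
    [AddCommGroup M₂] [AddCommGroup M₃] [inst₁ : Module ℤ M₁] [inst₂ : Module ℤ M₂]
    [inst₃ : Module ℤ M₃] [Module.Flat ℤ M₃] (f : M₁ →ₗ[ℤ] M₂) (g : M₂ →ₗ[ℤ] M₃)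
    (hfg : g ∘ₗ f = 0) (G : Type v) [AddCommGroup G] :
    Function.Exact (f.rTensor G) (g.rTensor G) ↔
      ∀ L ∈ bocksteinFamily G, Function.Exact (f.rTensor L.Carrier) (g.rTensor L.Carrier) := by
  -- The ℤ-module structures carried by objects of `ModuleCat ℤ` are replaced by the canonical ones;
  -- such a structure is unique.
  obtain rfl : inst₁ = AddCommGroup.toIntModule M₁ := Subsingleton.elim _ _
  obtain rfl : inst₂ = AddCommGroup.toIntModule M₂ := Subsingleton.elim _ _
  obtain rfl : inst₃ = AddCommGroup.toIntModule M₃ := Subsingleton.elim _ _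
  simp only [exact_rTensor_iff f g hfg]
  rw [tensorVanishing_iff_forall_bocksteinFamily, noTorsionBy_or_iff_forall_bocksteinFamily]
  exact ⟨fun h L hL => ⟨h.1 L hL, h.2 L hL⟩,
    fun h => ⟨fun L hL => (h L hL).1, fun L hL => (h L hL).2⟩⟩

/-- Vanishing of relative homology with coefficients in `G` is detected by the Bockstein family. -/
theorem subsingleton_relSingularHomology_iff_forall_bocksteinFamily {Y : Type u}
    [TopologicalSpace Y] (B : Set Y) (k : ℕ) (G : Type v) [AddCommGroup G] :
    Subsingleton (relSingularHomology k B G) ↔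
      ∀ L ∈ bocksteinFamily G, Subsingleton (relSingularHomology k B L.Carrier) := by
  simp only [subsingleton_relSingularHomology_iff]
  have : Module.Flat ℤ ((relFreeChains ℤ B).sc k).X₃ := flat_relFreeChains_X ℤ B _
  refine exact_rTensor_iff_forall_bocksteinFamily _ _ ?_ G
  exact congrArg ModuleCat.Hom.hom ((relFreeChains ℤ B).sc k).zero

end Bockstein
end

theorem theorem5p4 {X : Type u} [TopologicalSpace X] {A : Set X} (hA : IsClosed A)
    (G : Type v) [AddCommGroup G] (n : ℕ∞) :
    Bockstein.IsHomologicalZSet G n A ↔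
      ∀ H ∈ Bockstein.bocksteinFamily G, Bockstein.IsHomologicalZSet H.Carrier n A := by
  constructor
  · intro h L hL
    exact ⟨hA, fun U hU k hk =>
      (Bockstein.subsingleton_relSingularHomology_iff_forall_bocksteinFamily _ k G).1
        (h.2 U hU k hk) L hL⟩
  · intro h
    exact ⟨hA, fun U hU k hk =>
      (Bockstein.subsingleton_relSingularHomology_iff_forall_bocksteinFamily _ k G).2
        fun L hL => (h L hL).2 U hU k hk⟩
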